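/- **Definitions.** Let $d$ be a distance on a set $A$. Write $B_r(x)=\{y: d(x,y)<r\}$ and $(y,z)_x=\tfrac12\big(d(x,y)+d(x,z)-d(y,z)\big)$. * $(A,d)$ is *$\delta$-hyperbolic* if $(x,z)_w\ge \min\big((x,y)_w,(y,z)_w\big)-\delta$ for all $x,y,z,w\in A$. * A measure $\mu$ on $(A,d)$ has *$(a,b)$-pinched exponential growth* if there are constants $c,C>0$ such that $c\,a^r\le\mu(B_r(x))\le C\,b^r$ for all $x\in A$ and all real $r\ge 1$. * $\mu$ is *locally doubling* if all balls of positive radius have positive finite measure and for each $s>0$ there is a finite constant $L_s$ such that $\mu(B_{2r}(x))\le L_s\,\mu(B_r(x))$ for all $x\in A$ and $0<r\le s$. * For $\delta\ge 0$ and $1<a\le b$, the class $\mathcal X_{a,b}^{\delta}$ consists of all $(X,d,\mu)$, where $(X,d)$ is a connected, noncompact, complete, $\delta$-hyperbolic metric space with strictly intrinsic metric (any two points are joined by a continuous path whose length equals their distance) and $\mu$ is a locally doubling Borel measure on $X$ with $(a,b)$-pinched exponential growth. * Let $\mathrm T$ be a tree with root $o$. The *level* of a vertex $x$ is its tree distance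 from $o$, and the *predecessor* of $x\ne o$ is its unique neighbour in $\mathrm T$ whose level is one less than that of $x$. A *spider's web* $\widehat\Gamma$ associated to $\mathrm T$ is a simple graph, in which every vertex has finitely many neighbours, obtained from $\mathrm T$ by adding a (possibly empty) set of edges on the same vertices, such that (i) every added edge joins two vertices of the same level; (ii) if two vertices of the same level are adjacent in $\widehat\Gamma$, then their predecessors coincide or are adjacent in $\widehat\Gamma$. It is endowed with its graph distance $d_{\widehat\Gamma}$ and the counting measure $\mu_{\widehat\Gamma}$ on its vertices. * For $\beta\ge0$, a map $\varphi:(A,d)\to(A',d')$ is a *strict $\beta$-rough isometry* if $d(x,y)-\beta\le d'(\varphi(x),\varphi(y))\le d(x,y)+\beta$ for all $x,y\in A$, and every point of $A'$ lies within a bounded distance, uniformly, of $\varphi(A)$. **Theorem.** Let $\delta\ge0$ and $1<a\le b$, and let $(X,d,\mu)$ belong to $\mathcal X_{a,b}^{\delta}$. Then there exist $\delta'>0$, a closed discrete subset $V$ of $X$, a rooted tree $\mathrm T$ with vertex set $V$, and a spider's web $\widehat\Gamma$ associated to $\mathrm T$ such that 1. $(\widehat\Gamma,d_{\widehat\Gamma})$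 is $\delta'$-hyperbolic; 2. the counting measure $\mu_{\widehat\Gamma}$ has $(a,b)$-pinched exponential growth with respect to $d_{\widehat\Gamma}$; 3. for some $\beta\ge 0$ the inclusion $V\hookrightarrow X$ is a strict $\beta$-rough isometry from $(\widehat\Gamma,d_{\widehat\Gamma})$ to $(X,d)$; in particular $\widehat\Gamma$ is strictly roughly isometric to $X$. -/

import Mathlib

open MeasureTheory
open scoped ENNReal NNReal

namespace SpidersWeb

/-- The Gromov product `(y, z)_x` with respect to the distance function `d`. Distances are passed
explicitly since the same set will carry both a metric and a graph distance. -/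
noncomputable def gromovProduct {A : Type*} (d : A → A → ℝ) (y z x : A) : ℝ :=
  (1 / 2) * (d x y + d x z - d y z)

/-- Gromov hyperbolicity with constant `δ`: the four points condition. -/
def IsHyperbolic {A : Type*} (d : A → A → ℝ) (δ : ℝ) : Prop :=
  ∀ x y z w : A,
    min (gromovProduct d x y w) (gromovProduct d y z w) - δ ≤ gromovProduct d x z w

/-- A map `f` from `(A, d)` to `(B, d')` is an `(L, β)`-rough isometry. It is a strict
`β`-rough isometry when `L = 1`. -/
structure IsRoughIsometry {A B : Type*} (d : A → A → ℝ) (d' : B → B → ℝ) (L β : ℝ)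
    (f : A → B) : Prop where
  one_le : 1 ≤ L
  nonneg : 0 ≤ β
  lower : ∀ x y : A, (1 / L) * d x y - β ≤ d' (f x) (f y)
  upper : ∀ x y : A, d' (f x) (f y) ≤ L * d x y + β
  cobounded : ∃ M : ℝ, ∀ z : B, ∃ x : A, d' (f x) z ≤ M

/-- `(a, b)`-pinched exponential growth at infinity of the measures of the open balls of the
distance `d`. -/
def HasPinchedGrowth {A : Type*} [MeasurableSpace A] (d : A → A → ℝ) (μ : Measure A)
    (a b : ℝ) : Prop :=
  ∃ c C : ℝ, 0 < c ∧ 0 < C ∧ ∀ (x : A) (r : ℝ), 1 ≤ r →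
    ENNReal.ofReal (c * a ^ r) ≤ μ {y | d x y < r} ∧
      μ {y | d x y < r} ≤ ENNReal.ofReal (C * b ^ r)

/-- The metric is strictly intrinsic: any two points are joined by a continuous path whose length
(total variation) equals their distance. -/
def IsStrictlyIntrinsic (X : Type*) [MetricSpace X] : Prop :=
  ∀ x y : X, ∃ γ : Path x y, eVariationOn (fun t => γ t) Set.univ = edist x y

/-- The local doubling property: all balls have positive and finite measure, and the doubling
inequality holds uniformly for all balls of radius at most `s`, for each `s > 0`. -/
structure IsLocallyDoubling {X : Type*} [MetricSpace X] [MeasurableSpace X]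
    (μ : Measure X) : Prop where
  pos : ∀ (x : X) (r : ℝ), 0 < r → 0 < μ (Metric.ball x r)
  finite : ∀ (x : X) (r : ℝ), 0 < r → μ (Metric.ball x r) < ∞
  doubling : ∀ s : ℝ, 0 < s → ∃ L : ℝ≥0, ∀ (x : X) (r : ℝ), 0 < r → r ≤ s →
    μ (Metric.ball x (2 * r)) ≤ L * μ (Metric.ball x r)

/-- The class of connected noncompact complete `δ`-hyperbolic length spaces, with strictly
intrinsic metric, endowed with a locally doubling Borel measure with `(a, b)`-pinched exponential
growth at infinity. -/
structure MemClassX (δ a b : ℝ) (X : Type*) [MetricSpace X] [MeasurableSpace X] [BorelSpace X]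
    (μ : Measure X) : Prop where
  connected : ConnectedSpace X
  noncompact : NoncompactSpace X
  complete : CompleteSpace X
  strictlyIntrinsic : IsStrictlyIntrinsic X
  hyperbolic : IsHyperbolic (fun x y : X => dist x y) δ
  locallyDoubling : IsLocallyDoubling μ
  growth : HasPinchedGrowth (fun x y : X => dist x y) μ a b

/-- In the tree `T` with root `o`, the vertex `y` is the predecessor of `x`: the neighbour of `x`
whose level (distance from the root) is one less than that of `x`. -/
def IsPredecessor {V : Type*} (T : SimpleGraph V) (o y x : V) : Prop :=
  T.Adj x y ∧ T.dist o y + 1 = T.dist o x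

/-- The graph `G` is a spider's web obtained from the tree `T` with root `o` by adding edges.
All graphs have finite valences. -/
structure IsSpidersWeb {V : Type*} (T : SimpleGraph V) (o : V) (G : SimpleGraph V) : Prop where
  isTree : T.IsTree
  le : T ≤ G
  finite_valence : ∀ x : V, (G.neighborSet x).Finite
  level_eq_of_new_edge : ∀ x y : V, G.Adj x y → ¬ T.Adj x y → T.dist o x = T.dist o y
  predecessors : ∀ x y : V, G.Adj x y → T.dist o x = T.dist o y →
    ∀ x' y' : V, IsPredecessor T o x' x → IsPredecessor T o y' y → x' = y' ∨ G.Adj x' y'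

/-- The graph distance, as a real-valued function. -/
noncomputable def graphDist {V : Type*} (G : SimpleGraph V) (x y : V) : ℝ := (G.dist x y : ℝ)

/-- The class of `δ`-hyperbolic spider's webs whose counting measure has `(a, b)`-pinched
exponential growth, with respect to the graph distance of the web. -/
structure MemClassUpsilon (δ a b : ℝ) {V : Type*} (T : SimpleGraph V) (o : V)
    (G : SimpleGraph V) : Prop where
  isSpidersWeb : IsSpidersWeb T o G
  hyperbolic : IsHyperbolic (graphDist G) δ
  growth : @HasPinchedGrowth V ⊤ (graphDist G) (@Measure.count V ⊤) a b

end SpidersWeb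

/-! Fix `o` in X and take for V a maximal 1-separated subset of the union of the spheres about `o`
of integer radius. Distance to `o` is the level; following a geodesic towards `o` down to the
preceding sphere and moving to a nearby point of V gives each vertex a parent at distance at most 2.
This defines the tree. The web also joins vertices of equal level having descendants, equally many
generations below, within R of each other; this makes condition (ii) automatic.

The heart is that the graph distance and d differ by a bounded amount
(`exists_abs_graphDist_sub_dist_le`). Everything rests on one chain estimate,
`exists_sub_le_gromovProduct`: when the products of consecutive points grow linearly, the loss δ at
each use of hyperbolicity does not accumulate. It shows that lines of ancestors are roughly
geodesic, so that climbing from x and y to level about (x,y)_o, crossing one horizontal edge and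
descending is nearly optimal; it also shows that no walk can be much shorter than the distance.

Hyperbolicity then passes to the graph. Packing and covering by balls give the growth of V for d,
and bounded comparison gives it for the graph distance. -/

namespace SpidersWeb

/-! ### Chains of points in hyperbolic spaces. -/

section Hyperbolic

variable {A : Type*} {d : A → A → ℝ} {δ : ℝ}

theorem IsHyperbolic.sub_natCast_mul_le (h : IsHyperbolic d δ) (hδ : 0 ≤ δ) (o : A) (f : ℕ → A)
    (a : ℝ) (n : ℕ) (h0 : a ≤ gromovProduct d (f 0) (f 0) o)
    (hf : ∀ i < n, a + i ≤ gromovProduct d (f i) (f (i + 1)) o) :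
    a - n * δ ≤ gromovProduct d (f 0) (f n) o := by
  induction n with
  | zero => simpa using h0
  | succ n ih =>
    have h1 := ih fun i hi => hf i (by omega)
    have h2 := hf n (by omega)
    have h3 := h (f 0) (f n) (f (n + 1)) o
    have h4 : 0 ≤ n * δ := by positivity
    have h5 : a - n * δ ≤
        min (gromovProduct d (f 0) (f n) o) (gromovProduct d (f n) (f (n + 1)) o) :=
      le_min h1 (by linarith [(Nat.cast_nonneg n : (0 : ℝ) ≤ n)])
    push_cast
    linarith

/-- If the Gromov products of consecutive points of a finite sequence grow at least linearly, then
the Gromov product of the end points is controlled by the first one, independently of the length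
of the sequence. -/
theorem IsHyperbolic.exists_sub_le_gromovProduct (h : IsHyperbolic d δ) (hδ : 0 ≤ δ) :
    ∃ C : ℝ, 0 ≤ C ∧ ∀ (o : A) (n : ℕ) (f : ℕ → A) (a : ℝ),
      (∀ i ≤ n, a + i ≤ gromovProduct d (f i) (f i) o) →
      (∀ i < n, a + i ≤ gromovProduct d (f i) (f (i + 1)) o) →
      a - C ≤ gromovProduct d (f 0) (f n) o := by
  -- With K ≥ δ, a block of K steps costs Kδ, while the bound for the remaining chain starts at a +
  -- K. By induction the tail gives at least a + K - (K + 1)δ ≥ a - Kδ, so gluing block and tail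
  -- costs a single further δ.
  set K : ℕ := ⌈δ⌉₊ + 1 with hK
  have hKδ : δ ≤ K := (Nat.le_ceil δ).trans (by simp [hK])
  have hK1 : (1 : ℝ) ≤ K := by simp [hK]
  refine ⟨(K + 1) * δ, by positivity, fun o n => ?_⟩
  induction n using Nat.strong_induction_on with
  | _ n ih =>
    intro f a h0 hf
    have h00 : a ≤ gromovProduct d (f 0) (f 0) o := by simpa using h0 0 (by omega)
    rcases le_or_gt n K with hn | hn
    · have h1 := h.sub_natCast_mul_le hδ o f a n h00 hf
      have h2 : (n : ℝ) * δ ≤ K * δ := by gcongr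
      linarith
    · have h1 := h.sub_natCast_mul_le hδ o f a K h00 fun i hi => hf i (by omega)
      have h2 := ih (n - K) (by omega) (fun i => f (K + i)) (a + K)
        (fun i hi => by have := h0 (K + i) (by omega); push_cast at this; linarith)
        (fun i hi => by
          have := hf (K + i) (by omega)
          push_cast at this
          rw [← add_assoc]
          linarith)
      simp only [add_zero, Nat.add_sub_cancel' hn.le] at h2
      have h3 := h (f 0) (f K) (f n) o
      have h4 : a - K * δ ≤
          min (gromovProduct d (f 0) (f K) o) (gromovProduct d (f K) (f n) o) :=
        le_min h1 (by linarith)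
      linarith

/-- A distance at bounded difference from a hyperbolic one is hyperbolic. -/
theorem IsHyperbolic.of_abs_sub_le {d' : A → A → ℝ} {β : ℝ} (h : IsHyperbolic d δ)
    (hd : ∀ x y, |d' x y - d x y| ≤ β) : IsHyperbolic d' (δ + 3 * β) := by
  have key : ∀ x y w, |gromovProduct d' x y w - gromovProduct d x y w| ≤ 3 / 2 * β := by
    intro x y w
    have h1 := abs_le.1 (hd w x)
    have h2 := abs_le.1 (hd w y)
    have h3 := abs_le.1 (hd x y)
    unfold gromovProduct
    rw [abs_le]
    constructor <;> linarith
  intro x y z w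
  have h1 := abs_le.1 (key x y w)
  have h2 := abs_le.1 (key y z w)
  have h3 := abs_le.1 (key x z w)
  have h4 := h x y z w
  have h5 : min (gromovProduct d' x y w) (gromovProduct d' y z w) - 3 / 2 * β ≤
      min (gromovProduct d x y w) (gromovProduct d y z w) :=
    le_min (by linarith [min_le_left (gromovProduct d' x y w) (gromovProduct d' y z w)])
      (by linarith [min_le_right (gromovProduct d' x y w) (gromovProduct d' y z w)])
  linarith

end Hyperbolic

/-! ### The tree and the spider's web of a parent map. -/

section ParentMap

variable {V : Type*}

/-- `par` sends every vertex of level `n + 1` to a vertex of level `n`, and `o` is the only vertex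
of level `0`. -/
structure IsParentMap (o : V) (lev : V → ℕ) (par : V → V) : Prop where
  lev_root : lev o = 0
  eq_root : ∀ x, lev x = 0 → x = o
  lev_par : ∀ x, lev x ≠ 0 → lev (par x) + 1 = lev x

/-- The graph joining each vertex to its parent. -/
def parentTree (lev : V → ℕ) (par : V → V) : SimpleGraph V where
  Adj x y := (lev y = lev x + 1 ∧ par y = x) ∨ (lev x = lev y + 1 ∧ par x = y)
  symm := ⟨fun _ _ h => h.symm⟩
  loopless := ⟨fun x h => by omega⟩

/-- The graph obtained from the parent tree by joining two vertices `x` and `y` of the same level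
whenever, for some `k`, they have descendants `k` generations below at distance at most `R`. -/
def parentWeb [PseudoMetricSpace V] (lev : V → ℕ) (par : V → V) (R : ℝ) : SimpleGraph V where
  Adj x y := (parentTree lev par).Adj x y ∨ (x ≠ y ∧ lev x = lev y ∧ ∃ (k : ℕ) (u v : V),
    lev u = lev x + k ∧ lev v = lev y + k ∧ par^[k] u = x ∧ par^[k] v = y ∧ dist u v ≤ R)
  symm := ⟨fun x y h => by
    rcases h with h | ⟨h1, h2, k, u, v, hu, hv, hux, hvy, huv⟩
    · exact Or.inl h.symm
    · exact Or.inr ⟨h1.symm, h2.symm, k, v, u, hv, hu, hvy, hux, by rwa [dist_comm]⟩⟩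
  loopless := ⟨fun x h => by
    rcases h with h | h
    · exact h.ne rfl
    · exact h.1 rfl⟩

variable {o : V} {lev : V → ℕ} {par : V → V}

theorem IsParentMap.lev_iterate (h : IsParentMap o lev par) {k j : ℕ} {x : V}
    (hx : lev x = k + j) : lev (par^[j] x) = k := by
  induction j generalizing x with
  | zero => simpa using hx
  | succ j ih =>
    have := h.lev_par x (by omega)
    rw [Function.iterate_succ_apply]
    exact ih (by omega)

theorem IsParentMap.adj_par (h : IsParentMap o lev par) {x : V} (hx : lev x ≠ 0) :
    (parentTree lev par).Adj x (par x) :=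
  Or.inr ⟨(h.lev_par x hx).symm, rfl⟩

theorem IsParentMap.exists_walk (h : IsParentMap o lev par) {k j : ℕ} {x : V}
    (hx : lev x = k + j) : ∃ p : (parentTree lev par).Walk x (par^[j] x), p.length = j := by
  induction j generalizing x with
  | zero => exact ⟨.nil, rfl⟩
  | succ j ih =>
    have h0 : lev x ≠ 0 := by omega
    have := h.lev_par x h0
    obtain ⟨p, hp⟩ := ih (x := par x) (by omega)
    exact ⟨.cons (h.adj_par h0) p, by simp [hp]⟩

theorem IsParentMap.iterate_lev (h : IsParentMap o lev par) (x : V) : par^[lev x] x = o :=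
  h.eq_root _ (h.lev_iterate (k := 0) (by omega))

theorem IsParentMap.isTree (h : IsParentMap o lev par) : (parentTree lev par).IsTree := by
  refine ⟨?_, ?_⟩
  · rw [SimpleGraph.connected_iff_exists_forall_reachable]
    refine ⟨o, fun x => ?_⟩
    obtain ⟨p, -⟩ := h.exists_walk (k := 0) (j := lev x) (x := x) (by omega)
    rw [h.iterate_lev] at p
    exact p.reachable.symm
  · have key : ∀ x, lev x ≠ 0 → (parentTree lev par).IsBridge s(x, par x) := by
      intro x hx
      rw [SimpleGraph.isBridge_iff]
      -- Without the edge from x to its parent, a walk cannot leave the descendants of x, and `par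
      -- x` has too low a level to be one. The level clause prevents iterating past the root, where
      -- `par` is arbitrary.
      have inv : ∀ y z, ((parentTree lev par).deleteEdges {s(x, par x)}).Walk y z →
          (∃ k, lev y = lev x + k ∧ par^[k] y = x) → ∃ k, lev z = lev x + k ∧ par^[k] z = x := by
        intro y z p
        induction p with
        | nil => exact id
        | cons hadj p ih =>
          rename_i u v w
          rintro ⟨k, hk, hku⟩
          refine ih ?_
          rw [SimpleGraph.deleteEdges_adj] at hadj
          obtain ⟨hadj | hadj, hne⟩ := hadj
          · exact ⟨k + 1, by omega, by rw [Function.iterate_succ_apply, hadj.2, hku]⟩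
          · obtain - | k := k
            · obtain rfl : u = x := hku
              simp [hadj.2] at hne
            · refine ⟨k, by omega, ?_⟩
              rwa [Function.iterate_succ_apply, hadj.2] at hku
      rintro ⟨p⟩
      obtain ⟨k, hk, -⟩ := inv _ _ p ⟨0, rfl, rfl⟩
      have := h.lev_par x hx
      omega
    rw [SimpleGraph.isAcyclic_iff_forall_adj_isBridge]
    rintro x y (⟨hxy, rfl⟩ | ⟨hxy, rfl⟩)
    · rw [Sym2.eq_swap]
      exact key y (by omega)
    · exact key x (by omega)

theorem lev_le_add_length {G : SimpleGraph V} (hG : ∀ x y, G.Adj x y → lev y ≤ lev x + 1)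
    {x y : V} (p : G.Walk x y) : lev y ≤ lev x + p.length := by
  induction p with
  | nil => simp
  | cons hadj p ih =>
    have := hG _ _ hadj
    rw [SimpleGraph.Walk.length_cons]
    omega

theorem IsParentMap.dist_eq (h : IsParentMap o lev par) (x : V) :
    (parentTree lev par).dist o x = lev x := by
  apply le_antisymm
  · obtain ⟨p, hp⟩ := h.exists_walk (k := 0) (j := lev x) (x := x) (by omega)
    have := SimpleGraph.dist_le p
    rwa [hp, h.iterate_lev, SimpleGraph.dist_comm] at this
  · obtain ⟨p, hp⟩ := (h.isTree.connected o x).exists_walk_length_eq_dist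
    have := lev_le_add_length (lev := lev) (fun x y hxy => by rcases hxy with hxy | hxy <;> omega) p
    rw [h.lev_root] at this
    omega

theorem IsParentMap.eq_par_of_isPredecessor (h : IsParentMap o lev par) {x y : V}
    (hxy : IsPredecessor (parentTree lev par) o y x) : lev x ≠ 0 ∧ y = par x := by
  obtain ⟨hadj, hd⟩ := hxy
  rw [h.dist_eq, h.dist_eq] at hd
  rcases hadj with hadj | hadj
  · omega
  · exact ⟨by omega, hadj.2.symm⟩

/-- Condition (ii) holds because the descendants `u`, `v` witnessing a horizontal edge also witness
one between the parents, with `k + 1` generations, unless the parents coincide. -/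
theorem IsParentMap.isSpidersWeb [PseudoMetricSpace V] (h : IsParentMap o lev par) (R : ℝ)
    (hfin : ∀ x, ((parentWeb lev par R).neighborSet x).Finite) :
    IsSpidersWeb (parentTree lev par) o (parentWeb lev par R) where
  isTree := h.isTree
  le := fun _ _ => Or.inl
  finite_valence := hfin
  level_eq_of_new_edge := by
    intro x y hxy hT
    rw [h.dist_eq, h.dist_eq]
    exact (hxy.resolve_left hT).2.1
  predecessors := by
    intro x y hxy hlev x' y' hx' hy'
    rw [h.dist_eq, h.dist_eq] at hlev
    obtain ⟨hx0, rfl⟩ := h.eq_par_of_isPredecessor hx'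
    obtain ⟨hy0, rfl⟩ := h.eq_par_of_isPredecessor hy'
    obtain (hT | hT) | ⟨-, -, k, u, v, hu, hv, rfl, rfl, huv⟩ := hxy
    · omega
    · omega
    · have h1 := h.lev_par _ hx0
      have h2 := h.lev_par _ hy0
      refine or_iff_not_imp_left.2 fun hne => Or.inr ⟨hne, by omega, k + 1, u, v, by omega,
        by omega, ?_, ?_, huv⟩ <;> rw [Function.iterate_succ_apply']

end ParentMap

/-! ### Comparison of the graph distance with the metric. -/

section Comparison

variable {V : Type*} [PseudoMetricSpace V] {o : V} {lev : V → ℕ} {par : V → V} {δ : ℝ}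

theorem gromovProduct_eq_of_dist_eq (hdist : ∀ x : V, dist o x = lev x) (x y : V) :
    gromovProduct (fun x y => dist x y) x y o = 1 / 2 * (lev x + lev y - dist x y) := by
  simp [gromovProduct, hdist]

/-- Lines of ancestors are roughly geodesic: consecutive ancestors of levels k + i and k + i + 1 are
at distance at most 2, so their product is at least k + i - 1/2 and the chain estimate applies. -/
theorem IsParentMap.exists_sub_le_gromovProduct_iterate (hp : IsParentMap o lev par)
    (hdist : ∀ x : V, dist o x = lev x) (hpar : ∀ x, lev x ≠ 0 → dist x (par x) ≤ 2)
    (hδ : 0 ≤ δ) (hyp : IsHyperbolic (fun x y : V => dist x y) δ) :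
    ∃ c : ℝ, 0 ≤ c ∧ ∀ (k j : ℕ) (x : V), lev x = k + j →
      k - c ≤ gromovProduct (fun x y => dist x y) (par^[j] x) x o := by
  obtain ⟨C, hC, key⟩ := hyp.exists_sub_le_gromovProduct hδ
  refine ⟨C + 1 / 2, by positivity, fun k j x hx => ?_⟩
  have hlev : ∀ i ≤ j, lev (par^[j - i] x) = k + i := fun i hi => hp.lev_iterate (by omega)
  have := key o j (fun i => par^[j - i] x) (k - 1 / 2) (fun i hi => ?_) fun i hi => ?_
  · simp only [Nat.sub_zero, Nat.sub_self, Function.iterate_zero, id_eq] at this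
    linarith
  · rw [gromovProduct_eq_of_dist_eq hdist, hlev i hi]
    simp only [dist_self]
    push_cast
    linarith
  · have h1 := hlev (i + 1) (by omega)
    have h2 : par^[j - i] x = par (par^[j - (i + 1)] x) := by
      rw [← Function.iterate_succ_apply' par]
      congr 1
      omega
    rw [gromovProduct_eq_of_dist_eq hdist, hlev i hi.le, h1, h2, dist_comm]
    have := hpar _ (by omega : lev (par^[j - (i + 1)] x) ≠ 0)
    push_cast
    linarith

/-- In a graph whose edges have bounded length and change the distance from the root by at most
one, distances are at most the lengths of walks, up to an additive constant. -/
theorem exists_dist_le_length_add (hdist : ∀ x : V, dist o x = lev x)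
    (hδ : 0 ≤ δ) (hyp : IsHyperbolic (fun x y : V => dist x y) δ) {G : SimpleGraph V} {D : ℝ}
    (hD : 0 ≤ D) (hG : ∀ x y, G.Adj x y → dist x y ≤ D)
    (hlev : ∀ x y, G.Adj x y → lev y ≤ lev x + 1) :
    ∃ β : ℝ, 0 ≤ β ∧ ∀ (x y : V) (p : G.Walk x y), dist x y ≤ p.length + β := by
  obtain ⟨C, hC, key⟩ := hyp.exists_sub_le_gromovProduct hδ
  refine ⟨2 * (C + δ) + D + 2, by positivity, fun x y p => ?_⟩
  have hadj : ∀ u v, G.Adj u v → lev u - (D + 1) / 2 ≤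
      gromovProduct (fun x y => dist x y) u v o := by
    intro u v huv
    have h1 : (lev u : ℝ) ≤ lev v + 1 := mod_cast hlev v u huv.symm
    rw [gromovProduct_eq_of_dist_eq hdist]
    linarith [hG u v huv]
  have hself : ∀ u, lev u - (D + 1) / 2 ≤ gromovProduct (fun x y => dist x y) u u o := by
    intro u
    rw [gromovProduct_eq_of_dist_eq hdist, dist_self]
    linarith
  have hl : ∀ i ≤ p.length, lev x ≤ lev (p.getVert i) + i := by
    intro i hi
    simpa [hi] using lev_le_add_length hlev (p.take i).reverse
  have hr : ∀ i ≤ p.length, lev y ≤ lev (p.getVert i) + (p.length - i) := by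
    intro i hi
    simpa using lev_le_add_length hlev (p.drop i)
  have h0 := hl p.length le_rfl
  have h1 := hr 0 (Nat.zero_le _)
  simp only [SimpleGraph.Walk.getVert_length] at h0
  simp only [SimpleGraph.Walk.getVert_zero] at h1
  -- After i steps the level is at least `lev x - i`, and at least `lev y - (p.length - i)`. The two
  -- bounds meet near step t, at height about q; from there the lower bound rises linearly towards
  -- either end, as the chain estimate requires. Rounding t down costs at most 1/2, absorbed in
  -- passing from (D + 1)/2 to (D + 2)/2.
  obtain ⟨t, ht⟩ : ∃ t, t = (lev x + p.length - lev y) / 2 := ⟨_, rfl⟩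
  have htl : t ≤ p.length := by omega
  have ht1 : (2 * t : ℝ) ≤ lev x + p.length - lev y := by
    have : 2 * t + lev y ≤ lev x + p.length := by omega
    have : (2 * t + lev y : ℝ) ≤ lev x + p.length := mod_cast this
    linarith
  have ht2 : (lev x + p.length - lev y - 1 : ℝ) ≤ 2 * t := by
    have : lev x + p.length ≤ 2 * t + lev y + 1 := by omega
    have : (lev x + p.length : ℝ) ≤ 2 * t + lev y + 1 := mod_cast this
    linarith
  set q : ℝ := (lev x + lev y - p.length) / 2 with hq
  have hback : ∀ i ≤ t, q - (D + 2) / 2 + i ≤ lev (p.getVert (t - i)) - (D + 1) / 2 := by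
    intro i hi
    have h2 := hl (t - i) (by omega)
    have h3 : lev x + i ≤ lev (p.getVert (t - i)) + t := by omega
    have h3 : (lev x + i : ℝ) ≤ lev (p.getVert (t - i)) + t := mod_cast h3
    linarith
  have hforw : ∀ i ≤ p.length - t, q - (D + 2) / 2 + i ≤
      lev (p.getVert (t + i)) - (D + 1) / 2 := by
    intro i hi
    have h2 := hr (t + i) (by omega)
    have h3 : lev y + (t + i) ≤ lev (p.getVert (t + i)) + p.length := by omega
    have h3 : (lev y + (t + i) : ℝ) ≤ lev (p.getVert (t + i)) + p.length := mod_cast h3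
    linarith
  have k1 := key o t (fun i => p.getVert (t - i)) (q - (D + 2) / 2)
    (fun i hi => (hback i hi).trans (hself _)) fun i hi => (hback i hi.le).trans (hadj _ _ (by
      have := p.adj_getVert_succ (i := t - (i + 1)) (by omega)
      rw [show t - (i + 1) + 1 = t - i by omega] at this
      exact this.symm))
  have k2 := key o (p.length - t) (fun i => p.getVert (t + i)) (q - (D + 2) / 2)
    (fun i hi => (hforw i hi).trans (hself _)) fun i hi => (hforw i hi.le).trans (hadj _ _
      (p.adj_getVert_succ (i := t + i) (by omega)))
  simp only [Nat.sub_zero, Nat.sub_self, SimpleGraph.Walk.getVert_zero] at k1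
  simp only [Nat.add_zero, Nat.add_sub_cancel' htl, SimpleGraph.Walk.getVert_length] at k2
  -- Gluing at the turning point bounds (y,x)_o below by q minus a constant, which is the claim
  -- since `2 * q = lev x + lev y - p.length`.
  have k3 := hyp y (p.getVert t) x o
  have k4 : q - (D + 2) / 2 - C ≤ min
      (gromovProduct (fun x y => dist x y) y (p.getVert t) o)
      (gromovProduct (fun x y => dist x y) (p.getVert t) x o) := by
    refine le_min ?_ k1
    rw [gromovProduct_eq_of_dist_eq hdist] at k2 ⊢
    rw [dist_comm]
    linarith
  rw [gromovProduct_eq_of_dist_eq hdist y x, dist_comm] at k3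
  linarith

theorem IsParentMap.exists_abs_graphDist_sub_dist_le (hp : IsParentMap o lev par)
    (hdist : ∀ x : V, dist o x = lev x) (hpar : ∀ x, lev x ≠ 0 → dist x (par x) ≤ 2)
    (hδ : 0 ≤ δ) (hyp : IsHyperbolic (fun x y : V => dist x y) δ) :
    ∃ R D β : ℝ, 0 ≤ β ∧ (∀ x y, (parentWeb lev par R).Adj x y → dist x y ≤ D) ∧
      ∀ x y, |graphDist (parentWeb lev par R) x y - dist x y| ≤ β := by
  obtain ⟨c, hc, hanc⟩ := hp.exists_sub_le_gromovProduct_iterate hdist hpar hδ hyp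
  have hgp := gromovProduct_eq_of_dist_eq hdist
  have hyp3 : ∀ (x y z w : V) (g : ℝ),
      g ≤ gromovProduct (fun x y => dist x y) x y o →
      g ≤ gromovProduct (fun x y => dist x y) y z o →
      g ≤ gromovProduct (fun x y => dist x y) z w o →
      g - 2 * δ ≤ gromovProduct (fun x y => dist x y) x w o := by
    intro x y z w g h1 h2 h3
    have h4 := hyp x y z o
    have h5 := hyp x z w o
    have h6 := le_min h1 h2
    have h7 := le_min (by linarith : g - δ ≤ gromovProduct (fun x y => dist x y) x z o)
      (by linarith : g - δ ≤ gromovProduct (fun x y => dist x y) z w o)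
    linarith
  have hcomm : ∀ x y : V, gromovProduct (fun x y => dist x y) x y o =
      gromovProduct (fun x y => dist x y) y x o := by
    intro x y
    rw [hgp, hgp, dist_comm, add_comm (lev x : ℝ)]
  -- R is dictated by the upper bound: the ancestors of x and y at a level k ≤ (x,y)_o have product
  -- at least k - c - 2δ, hence lie within 2c + 4δ.
  obtain ⟨R, hR⟩ : ∃ R, R = 2 * c + 4 * δ := ⟨_, rfl⟩
  have hadj : ∀ x y, (parentWeb lev par R).Adj x y → dist x y ≤ R + 4 * δ + 2 := by
    rintro x y ((⟨h, rfl⟩ | ⟨h, rfl⟩) | ⟨-, hxy, k, u, v, hu, hv, rfl, rfl, huv⟩)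
    · rw [dist_comm]
      linarith [hpar y (by omega)]
    · linarith [hpar x (by omega)]
    · set n := lev (par^[k] u) with hn
      have h1 := hanc n k u hu
      have h2 := hanc n k v (by omega)
      rw [hcomm] at h2
      -- Closeness of `u` and `v` propagates up to their ancestors; the bound on edge lengths does
      -- not depend on the number k of generations.
      have h3 := hyp3 (par^[k] u) u v (par^[k] v) (n - R / 2) (by linarith) (by
        rw [hgp, hu, hv, ← hxy]
        push_cast
        linarith [(Nat.cast_nonneg k : (0 : ℝ) ≤ k)]) (by linarith)
      rw [hgp, ← hxy] at h3
      linarith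
  have hlev : ∀ x y, (parentWeb lev par R).Adj x y → lev y ≤ lev x + 1 := by
    rintro x y ((h | h) | h) <;> omega
  obtain ⟨β, hβ, hwalk⟩ := exists_dist_le_length_add hdist hδ hyp
    (by linarith : 0 ≤ R + 4 * δ + 2) hadj hlev
  have hle : parentTree lev par ≤ parentWeb lev par R := fun _ _ => Or.inl
  have hconn : (parentWeb lev par R).Connected := hp.isTree.connected.mono hle
  refine ⟨R, R + 4 * δ + 2, β + 3, by positivity, hadj, fun x y => ?_⟩
  have hlow : dist x y ≤ graphDist (parentWeb lev par R) x y + β := by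
    obtain ⟨p, hpl⟩ := (hconn x y).exists_walk_length_eq_dist
    have := hwalk x y p
    rwa [hpl] at this
  have hup : graphDist (parentWeb lev par R) x y ≤ dist x y + 3 := by
    set g := gromovProduct (fun x y => dist x y) x y o with hg
    have hg' := hgp x y
    rw [← hg] at hg'
    have t1 := dist_triangle o x y
    have t2 := dist_triangle o y x
    have t3 := dist_triangle x o y
    rw [dist_comm y x] at t2
    rw [dist_comm x o] at t3
    rw [hdist, hdist] at t1 t2 t3
    have hg0 : 0 ≤ g := by linarith
    -- Up to level k, across at most one edge, and down: the length is at most lev x + lev y - 2k +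
    -- 1. Since k > g - 1, this is below d(x,y) + 3.
    obtain ⟨k, hk⟩ : ∃ k, k = ⌊g⌋₊ := ⟨_, rfl⟩
    have hkg : (k : ℝ) ≤ g := hk ▸ Nat.floor_le hg0
    have hgk : g < k + 1 := hk ▸ Nat.lt_floor_add_one g
    have hkx : k ≤ lev x := by exact_mod_cast (by linarith : (k : ℝ) ≤ lev x)
    have hky : k ≤ lev y := by exact_mod_cast (by linarith : (k : ℝ) ≤ lev y)
    obtain ⟨i, hi⟩ := Nat.exists_eq_add_of_le hkx
    obtain ⟨j, hj⟩ := Nat.exists_eq_add_of_le hky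
    obtain ⟨p, hpi⟩ := hp.exists_walk hi
    obtain ⟨q, hqj⟩ := hp.exists_walk hj
    have lx := hp.lev_iterate hi
    have ly := hp.lev_iterate hj
    have ax := hanc k i x hi
    have ay := hanc k j y hj
    rw [hcomm] at ay
    have hclose : dist (par^[i] x) (par^[j] y) ≤ R := by
      have := hyp3 (par^[i] x) x y (par^[j] y) (k - c) ax (by linarith) ay
      rw [hgp, lx, ly] at this
      linarith
    have hmid : (parentWeb lev par R).dist (par^[i] x) (par^[j] y) ≤ 1 := by
      by_cases hne : par^[i] x = par^[j] y
      · simp [hne]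
      · have hA : (parentWeb lev par R).Adj (par^[i] x) (par^[j] y) :=
          Or.inr ⟨hne, by omega, 0, _, _, rfl, rfl, rfl, rfl, hclose⟩
        exact (SimpleGraph.dist_eq_one_iff_adj.2 hA).le
    have d1 : (parentWeb lev par R).dist x (par^[i] x) ≤ i := by
      simpa [hpi] using SimpleGraph.dist_le (p.mapLe hle)
    have d2 : (parentWeb lev par R).dist (par^[j] y) y ≤ j := by
      simpa [hqj] using SimpleGraph.dist_le (q.mapLe hle).reverse
    have d3 := hconn.dist_triangle (u := x) (v := par^[i] x) (w := y)
    have d4 := hconn.dist_triangle (u := par^[i] x) (v := par^[j] y) (w := y)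
    have d5 : (parentWeb lev par R).dist x y ≤ i + j + 1 := by omega
    have d6 : graphDist (parentWeb lev par R) x y ≤ i + j + 1 := by
      unfold graphDist
      exact_mod_cast d5
    have e1 : (lev x : ℝ) = k + i := mod_cast hi
    have e2 : (lev y : ℝ) = k + j := mod_cast hj
    linarith
  rw [abs_le]
  constructor <;> linarith

end Comparison

/-! ### Points on geodesics and separated nets. -/

theorem IsStrictlyIntrinsic.exists_dist_eq {X : Type*} [MetricSpace X] (h : IsStrictlyIntrinsic X)
    (x y : X) {t : ℝ} (ht0 : 0 ≤ t) (ht : t ≤ dist x y) :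
    ∃ z, dist x z = t ∧ dist z y = dist x y - t := by
  obtain ⟨γ, hγ⟩ := h x y
  have hcont : Continuous fun s => dist x (γ s) := by fun_prop
  obtain ⟨s, hs⟩ := intermediate_value_univ (0 : unitInterval) 1 hcont
    (show t ∈ Set.Icc _ _ by simpa using ⟨ht0, ht⟩)
  simp only at hs
  refine ⟨γ s, hs, le_antisymm ?_ (by linarith [dist_triangle x (γ s) y])⟩
  -- The pieces of γ before and after s are at least as long as the distances between their ends,
  -- and together have length at most d(x,y).
  have h1 : edist x (γ s) ≤ eVariationOn (fun t => γ t) (Set.Iic s) := by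
    simpa using eVariationOn.edist_le (fun t => γ t) (s := Set.Iic s) (x := 0) (y := s)
      unitInterval.nonneg' Set.self_mem_Iic
  have h2 : edist (γ s) y ≤ eVariationOn (fun t => γ t) (Set.Ici s) := by
    simpa using eVariationOn.edist_le (fun t => γ t) (s := Set.Ici s) (x := s) (y := 1)
      Set.self_mem_Ici unitInterval.le_one'
  have h3 := eVariationOn.add_le_union (fun t => γ t) (s := Set.Iic s) (t := Set.Ici s)
    fun a ha b hb => le_trans ha hb
  rw [Set.Iic_union_Ici, hγ] at h3
  have h4 := (add_le_add h1 h2).trans h3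
  rw [edist_dist, edist_dist, edist_dist, ← ENNReal.ofReal_add dist_nonneg dist_nonneg,
    ENNReal.ofReal_le_ofReal_iff dist_nonneg] at h4
  linarith

/-- Every set contains a maximal `ε`-separated subset. -/
theorem exists_subset_pairwise_le_dist {X : Type*} [PseudoMetricSpace X] (S : Set X) {ε : ℝ}
    (hε : 0 < ε) : ∃ V ⊆ S, (V.Pairwise fun x y => ε ≤ dist x y) ∧
      ∀ x ∈ S, ∃ v ∈ V, dist x v < ε := by
  obtain ⟨V, hV⟩ := zorn_subset {V : Set X | V ⊆ S ∧ V.Pairwise fun x y => ε ≤ dist x y}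
    fun c hc hchain => ⟨⋃₀ c, ⟨Set.sUnion_subset fun s hs => (hc hs).1,
      (Set.pairwise_sUnion hchain.directedOn).2 fun s hs => (hc hs).2⟩,
      fun s hs => Set.subset_sUnion_of_mem hs⟩
  refine ⟨V, hV.prop.1, hV.prop.2, fun x hx => ?_⟩
  by_contra! hfar
  have hins : insert x V ∈ {V : Set X | V ⊆ S ∧ V.Pairwise fun x y => ε ≤ dist x y} := by
    refine ⟨Set.insert_subset hx hV.prop.1, hV.prop.2.insert fun v hv _ => ?_⟩
    exact ⟨hfar v hv, by rw [dist_comm]; exact hfar v hv⟩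
  have hxV : x ∈ V := hV.le_of_ge hins (Set.subset_insert x V) (Set.mem_insert x V)
  have := hfar x hxV
  rw [dist_self] at this
  linarith

/-! ### Growth of counting measures. -/

section Growth

/-- Pinched exponential growth of the counting measure passes to a distance at bounded difference
from the given one. -/
theorem HasPinchedGrowth.count_of_abs_sub_le {A : Type*} {d d' : A → A → ℝ} {a b β : ℝ}
    (ha : 1 ≤ a) (hb : 0 < b) (hβ : 0 ≤ β)
    (h : @HasPinchedGrowth A ⊤ d (@Measure.count A ⊤) a b)
    (hself : ∀ x, d' x x = 0) (hd : ∀ x y, |d' x y - d x y| ≤ β) :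
    @HasPinchedGrowth A ⊤ d' (@Measure.count A ⊤) a b := by
  let _ : MeasurableSpace A := ⊤
  have ha0 : 0 < a := by linarith
  obtain ⟨c, C, hc, hC, hcC⟩ := h
  refine ⟨min (c * a ^ (-β)) (a ^ (-(1 + β))), C * b ^ β, by positivity, by positivity,
    fun x r hr => ⟨?_, ?_⟩⟩
  -- The hypothesis applies at radius r - β only if this is at least 1. For smaller r the centre
  -- alone suffices, the constant being chosen to make the lower bound at most 1.
  · rcases le_or_gt (1 + β) r with hr' | hr'
    · calc ENNReal.ofReal (min (c * a ^ (-β)) (a ^ (-(1 + β))) * a ^ r)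
          ≤ ENNReal.ofReal (c * a ^ (r - β)) := by
            apply ENNReal.ofReal_le_ofReal
            rw [sub_eq_neg_add, Real.rpow_add ha0, ← mul_assoc]
            gcongr
            exact min_le_left _ _
        _ ≤ Measure.count {y | d x y < r - β} := (hcC x (r - β) (by linarith)).1
        _ ≤ Measure.count {y | d' x y < r} := by
            refine measure_mono fun y hy => ?_
            have := (abs_le.1 (hd x y)).2
            simp only [Set.mem_ofPred_eq] at hy ⊢
            linarith
    · calc ENNReal.ofReal (min (c * a ^ (-β)) (a ^ (-(1 + β))) * a ^ r)
          ≤ ENNReal.ofReal 1 := by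
            apply ENNReal.ofReal_le_ofReal
            calc min (c * a ^ (-β)) (a ^ (-(1 + β))) * a ^ r
                ≤ a ^ (-(1 + β)) * a ^ r := by
                  gcongr
                  exact min_le_right _ _
              _ = a ^ (-(1 + β) + r) := (Real.rpow_add ha0 _ _).symm
              _ ≤ 1 := Real.rpow_le_one_of_one_le_of_nonpos ha (by linarith)
        _ = Measure.count {x} := by simp
        _ ≤ Measure.count {y | d' x y < r} := by
            refine measure_mono fun y hy => ?_
            obtain rfl : y = x := hy
            simp only [Set.mem_ofPred_eq, hself]
            linarith
  · calc Measure.count {y | d' x y < r}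
        ≤ Measure.count {y | d x y < r + β} := by
          refine measure_mono fun y hy => ?_
          have := (abs_le.1 (hd x y)).1
          simp only [Set.mem_ofPred_eq] at hy ⊢
          linarith
      _ ≤ ENNReal.ofReal (C * b ^ (r + β)) := (hcC x (r + β) (by linarith)).2
      _ = ENNReal.ofReal (C * b ^ β * b ^ r) := by
          rw [Real.rpow_add hb]
          ring_nf

variable {X : Type*} [MetricSpace X] [MeasurableSpace X] {μ : Measure X} {a b : ℝ}

theorem IsLocallyDoubling.exists_ofReal_le_ball (hμ : IsLocallyDoubling μ) (ha : 0 < a)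
    (h : HasPinchedGrowth (fun x y : X => dist x y) μ a b) :
    ∃ e : ℝ, 0 < e ∧ ∀ x, ENNReal.ofReal e ≤ μ (Metric.ball x (1 / 2)) := by
  obtain ⟨c, C, hc, hC, hcC⟩ := h
  obtain ⟨L, hL⟩ := hμ.doubling (1 / 2) (by norm_num)
  refine ⟨c * a / (L + 1), by positivity, fun x => ?_⟩
  have h1 := (hcC x 1 le_rfl).1
  have h2 := hL x (1 / 2) (by norm_num) le_rfl
  rw [show (2 * (1 / 2) : ℝ) = 1 by norm_num] at h2
  rw [Real.rpow_one, show {y | dist x y < 1} = Metric.ball x 1 by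
    ext y; simp [dist_comm]] at h1
  rw [ENNReal.ofReal_div_of_pos (by positivity)]
  refine ENNReal.div_le_of_le_mul' ((h1.trans h2).trans ?_)
  gcongr
  rw [← ENNReal.ofReal_coe_nnreal]
  exact ENNReal.ofReal_le_ofReal (by linarith)

/-- Disjoint balls of radius 1/2, of measure at least e, bound the number of points above; balls of
radius 2, of measure at most C b², cover the ball of radius r - 2 and bound it below. -/
theorem HasPinchedGrowth.count_of_separated_of_covering [BorelSpace X]
    (h : HasPinchedGrowth (fun x y : X => dist x y) μ a b) (ha : 1 ≤ a) (hb : 0 < b)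
    {e : ℝ} (he : 0 < e) (hball : ∀ x, ENNReal.ofReal e ≤ μ (Metric.ball x (1 / 2))) {V : Set X}
    (hsep : V.Pairwise fun x y => 1 ≤ dist x y) (hcov : ∀ z, ∃ v ∈ V, dist z v < 2) :
    @HasPinchedGrowth V ⊤ (fun x y => dist x y) (@Measure.count V ⊤) a b := by
  have ha0 : 0 < a := by linarith
  obtain ⟨c, C, hc, hC, hcC⟩ := h
  have hup : ∀ (x : V) (r : ℝ), 1 ≤ r →
      ({y : V | dist x y < r}.encard : ℝ≥0∞) ≤ ENNReal.ofReal (C * b ^ (1 / 2 : ℝ) / e * b ^ r) := by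
    intro x r hr
    have h1 : ∑' v : {y : V | dist x y < r}, μ (Metric.ball (v : X) (1 / 2)) ≤
        μ {y | dist (x : X) y < r + 1 / 2} := by
      refine (tsum_meas_le_meas_iUnion_of_disjoint μ (fun v => measurableSet_ball) ?_).trans
        (measure_mono ?_)
      · intro u v huv
        refine Metric.ball_disjoint_ball ?_
        have := hsep u.1.2 v.1.2 fun h => huv (Subtype.ext (Subtype.ext h))
        linarith
      · refine Set.iUnion_subset fun v y hy => ?_
        have h2 : dist (x : X) v < r := v.2
        have h3 := dist_triangle_right (x : X) y v
        rw [Metric.mem_ball] at hy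
        simp only [Set.mem_ofPred_eq]
        linarith
    have h2 : ∑' v : {y : V | dist x y < r}, ENNReal.ofReal e ≤
        ENNReal.ofReal (C * b ^ (r + 1 / 2)) :=
      ((ENNReal.tsum_le_tsum fun v : {y : V | dist x y < r} => hball v).trans h1).trans
        (hcC x _ (by linarith)).2
    rw [ENNReal.tsum_const, ENat.card_coe_set_eq] at h2
    rw [show C * b ^ (1 / 2 : ℝ) / e * b ^ r = C * b ^ (r + 1 / 2) / e by
      rw [Real.rpow_add hb]; ring, ENNReal.ofReal_div_of_pos he]
    exact (ENNReal.le_div_iff_mul_le (Or.inl (by simpa using he)) (Or.inl ENNReal.ofReal_ne_top)).2 h2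
  have hlow : ∀ (x : V) (r : ℝ), 1 ≤ r →
      ENNReal.ofReal (min (c * a ^ (-2 : ℝ) / (C * b ^ (2 : ℝ))) (a ^ (-3 : ℝ)) * a ^ r) ≤
        ({y : V | dist x y < r}.encard : ℝ≥0∞) := by
    intro x r hr
    rcases le_or_gt 3 r with hr' | hr'
    · have hfin : {y : V | dist x y < r}.Finite := by
        rw [← Set.encard_ne_top_iff]
        intro htop
        have := hup x r hr
        rw [htop] at this
        exact ENNReal.ofReal_ne_top (top_le_iff.1 this)
      have h1 : μ {y | dist (x : X) y < r - 2} ≤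
          ∑' v : {y : V | dist x y < r}, μ {y | dist (v : X) y < 2} := by
        refine (measure_mono ?_).trans (measure_biUnion_le μ hfin.countable
          fun v : V => {y | dist (v : X) y < 2})
        intro z hz
        obtain ⟨v, hv, hzv⟩ := hcov z
        simp only [Set.mem_ofPred_eq] at hz
        refine Set.mem_biUnion (x := ⟨v, hv⟩) ?_ (by simpa [dist_comm] using hzv)
        have := dist_triangle (x : X) z v
        simp only [Set.mem_ofPred_eq, Subtype.dist_eq]
        linarith
      have h2 : ENNReal.ofReal (c * a ^ (r - 2)) ≤
          ∑' v : {y : V | dist x y < r}, ENNReal.ofReal (C * b ^ (2 : ℝ)) :=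
        ((hcC x (r - 2) (by linarith)).1.trans h1).trans
          (ENNReal.tsum_le_tsum fun v : {y : V | dist x y < r} => (hcC v 2 (by norm_num)).2)
      rw [ENNReal.tsum_const, ENat.card_coe_set_eq] at h2
      calc _ ≤ ENNReal.ofReal (c * a ^ (r - 2) / (C * b ^ (2 : ℝ))) := by
            apply ENNReal.ofReal_le_ofReal
            calc _ ≤ c * a ^ (-2 : ℝ) / (C * b ^ (2 : ℝ)) * a ^ r := by
                  gcongr
                  exact min_le_left _ _
              _ = _ := by
                  rw [sub_eq_add_neg, Real.rpow_add ha0]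
                  ring
        _ ≤ _ := by
            rw [ENNReal.ofReal_div_of_pos (by positivity)]
            exact ENNReal.div_le_of_le_mul h2
    · calc _ ≤ ENNReal.ofReal 1 := by
            apply ENNReal.ofReal_le_ofReal
            calc _ ≤ a ^ (-3 : ℝ) * a ^ r := by
                  gcongr
                  exact min_le_right _ _
              _ = a ^ (-3 + r) := (Real.rpow_add ha0 _ _).symm
              _ ≤ 1 := Real.rpow_le_one_of_one_le_of_nonpos ha (by linarith)
        _ = (({x} : Set V).encard : ℝ≥0∞) := by simp
        _ ≤ _ := by
            gcongr
            rintro y rfl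
            simp only [Set.mem_ofPred_eq, dist_self]
            linarith
  refine ⟨min (c * a ^ (-2 : ℝ) / (C * b ^ (2 : ℝ))) (a ^ (-3 : ℝ)), C * b ^ (1 / 2 : ℝ) / e,
    by positivity, by positivity, fun x r hr => ?_⟩
  rw [@Measure.count_apply _ ⊤ _ trivial]
  exact ⟨hlow x r hr, hup x r hr⟩

theorem HasPinchedGrowth.finite_setOf_dist_lt {A : Type*} {d : A → A → ℝ}
    (h : @HasPinchedGrowth A ⊤ d (@Measure.count A ⊤) a b) (x : A) (r : ℝ) :
    {y | d x y < r}.Finite := by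
  let _ : MeasurableSpace A := ⊤
  obtain ⟨c, C, hc, hC, hcC⟩ := h
  refine Set.Finite.subset (s := {y | d x y < max r 1}) ?_ fun y (hy : d x y < r) => lt_max_of_lt_left (b := r) hy
  refine Measure.count_apply_lt_top.1 ?_
  exact (hcC x _ (le_max_right r 1)).2.trans_lt ENNReal.ofReal_lt_top

end Growth

end SpidersWeb

/-! ### Construction of the net and conclusion. -/

theorem theorem5p1 {X : Type*} [MetricSpace X] [MeasurableSpace X] [BorelSpace X]
    (μ : Measure X) (δ a b : ℝ) (hδ : 0 ≤ δ) (ha : 1 < a) (hab : a ≤ b)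
    (hX : SpidersWeb.MemClassX δ a b X μ) :
    ∃ δ' : ℝ, 0 < δ' ∧
      ∃ V : Set X, IsClosed V ∧ DiscreteTopology V ∧
        ∃ (T : SimpleGraph V) (o : V) (G : SimpleGraph V),
          SpidersWeb.MemClassUpsilon δ' a b T o G ∧
          ∃ β : ℝ, SpidersWeb.IsRoughIsometry (SpidersWeb.graphDist G)
            (fun x y : X => dist x y) 1 β (fun v : V => (v : X)) := by
  have hb : 0 < b := by linarith
  have := hX.connected
  obtain ⟨o⟩ := (inferInstance : Nonempty X)
  obtain ⟨V, hVS, hsep, hmax⟩ :=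
    SpidersWeb.exists_subset_pairwise_le_dist {x : X | ∃ n : ℕ, dist o x = n} one_pos
  have hlevel : ∀ x : X, ∃ n : ℕ, x ∈ V → dist o x = n := fun x => by
    by_cases hx : x ∈ V
    · obtain ⟨n, hn⟩ := hVS hx
      exact ⟨n, fun _ => hn⟩
    · exact ⟨0, fun h => absurd h hx⟩
  choose lev hlev using hlevel
  -- A net point at distance less than 1 from an integer sphere lies on that same sphere, since
  -- levels are integers.
  have hnear : ∀ (x : X) (n : ℕ), dist o x = n → ∃ v ∈ V, dist x v < 1 ∧ lev v = n := by
    intro x n hx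
    obtain ⟨v, hv, hxv⟩ := hmax x ⟨n, hx⟩
    refine ⟨v, hv, hxv, ?_⟩
    have h1 := dist_triangle o x v
    have h2 := dist_triangle_right o x v
    rw [hx, hlev v hv] at h1 h2
    have h3 : lev v < n + 1 := by exact_mod_cast (by linarith : (lev v : ℝ) < n + 1)
    have h4 : n < lev v + 1 := by exact_mod_cast (by linarith : (n : ℝ) < lev v + 1)
    omega
  have hroot : ∀ v ∈ V, lev v = 0 → o = v := by
    intro v hv h0
    have := hlev v hv
    rwa [h0, Nat.cast_zero, dist_eq_zero] at this
  have hoV : o ∈ V := by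
    obtain ⟨v, hv, -, h0⟩ := hnear o 0 (by simp)
    rwa [hroot v hv h0]
  have hdist : ∀ x : V, dist (⟨o, hoV⟩ : V) x = lev x := fun x => hlev x x.2
  have hexpar : ∀ x : V, ∃ y : V, lev x ≠ 0 → lev y + 1 = lev x ∧ dist x y ≤ 2 := by
    intro x
    by_cases hx : lev x = 0
    · exact ⟨x, fun h => absurd hx h⟩
    obtain ⟨n, hn⟩ := Nat.exists_eq_succ_of_ne_zero hx
    have hox := hlev x x.2
    rw [hn, Nat.cast_succ] at hox
    obtain ⟨p, hp1, hp2⟩ := hX.strictlyIntrinsic.exists_dist_eq o x n.cast_nonneg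
      (by linarith)
    obtain ⟨v, hv, hpv, hlv⟩ := hnear p n hp1
    refine ⟨⟨v, hv⟩, fun _ => ⟨by simp [hlv, hn], ?_⟩⟩
    have := dist_triangle_left (x : X) v p
    simp only [Subtype.dist_eq]
    linarith
  choose par hpar using hexpar
  have hcov : ∀ z : X, ∃ v ∈ V, dist z v < 2 := by
    intro z
    obtain ⟨p, hp1, hp2⟩ := hX.strictlyIntrinsic.exists_dist_eq o z
      (Nat.cast_nonneg ⌊dist o z⌋₊) (Nat.floor_le dist_nonneg)
    obtain ⟨v, hv, hpv, -⟩ := hnear p _ hp1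
    refine ⟨v, hv, ?_⟩
    have h1 := dist_triangle_left z v p
    have h2 := Nat.lt_floor_add_one (dist o z)
    linarith
  have hP : SpidersWeb.IsParentMap (⟨o, hoV⟩ : V) (fun x => lev x) par :=
    { lev_root := by simpa using (hlev o hoV).symm
      eq_root := fun x h0 => Subtype.ext (hroot x x.2 h0).symm
      lev_par := fun x hx => (hpar x hx).1 }
  have hypV : SpidersWeb.IsHyperbolic (fun x y : V => dist x y) δ :=
    fun x y z w => hX.hyperbolic x y z w
  obtain ⟨R, D, β, hβ, hD, hcomp⟩ := hP.exists_abs_graphDist_sub_dist_le hdist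
    (fun x hx => (hpar x hx).2) hδ hypV
  obtain ⟨e, he, hball⟩ := hX.locallyDoubling.exists_ofReal_le_ball (by linarith) hX.growth
  have hgrowth := hX.growth.count_of_separated_of_covering ha.le hb he hball hsep hcov
  -- The summand 1 only serves to make the constant positive.
  refine ⟨δ + 3 * β + 1, by positivity, V, Metric.isClosed_of_pairwise_le_dist one_pos hsep,
    DiscreteTopology.of_forall_le_dist one_pos
      fun x y hxy => hsep x.2 y.2 fun h => hxy (Subtype.ext h),
    SpidersWeb.parentTree (fun x : V => lev x) par, ⟨o, hoV⟩,
    SpidersWeb.parentWeb (fun x : V => lev x) par R, ⟨hP.isSpidersWeb R fun x => ?_, ?_, ?_⟩, β, ?_⟩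
  · refine (hgrowth.finite_setOf_dist_lt x (D + 1)).subset fun y hy => ?_
    have := hD x y hy
    simp only [Set.mem_ofPred_eq]
    linarith
  · intro x y z w
    have := hypV.of_abs_sub_le hcomp x y z w
    linarith
  · exact hgrowth.count_of_abs_sub_le ha.le hb hβ (fun x => by simp [SpidersWeb.graphDist]) hcomp
  · refine ⟨le_rfl, hβ, fun x y => ?_, fun x y => ?_, 2, fun z => ?_⟩
    · have := (abs_le.1 (hcomp x y)).2
      rw [Subtype.dist_eq] at this
      linarith
    · have := (abs_le.1 (hcomp x y)).1
      rw [Subtype.dist_eq] at this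
      linarith
    · obtain ⟨v, hv, hzv⟩ := hcov z
      exact ⟨⟨v, hv⟩, by rw [dist_comm]; exact hzv.le⟩
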